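/- For a complete metric space $X$, let $PX$ denote the set of Radon probability measures $p$ on $X$ with finite first moment (every short, i.e. $1$-Lipschitz, function $f:X\to\mathbb{R}$ is $p$-integrable), with the Kantorovich metric $$d(p,q)=\sup_{f:X\to\mathbb{R}\text{ short}}\left|\int_X f\,dp-\int_X f\,dq\right|.$$ For metric spaces $A,B$, let $A\otimes B$ denote the set $A\times B$ with the metric $d\big((a,b),(a',b')\big)=d(a,a')+d(b,b')$. Let $X$ and $Y$ be complete metric spaces. Let $\nabla_{X,Y}:PX\otimes PY\to P(X\otimes Y)$ be the map sending $(p,q)$ to the product measure, that is, to the unique element of $P(X\otimes Y)$ with $$\int_{X\otimes Y} f\,d\nabla_{X,Y}(p,q)=\int_X\int_Y f(x,y)\,dq(y)\,dp(x)$$ for all short $f:X\otimes Y\to\mathbb{R}$, and let $\Delta_{X,Y}:P(X\otimes Y)\to PX\otimes PY$ be the map sending $r$ to its pair of marginals $(r_X,r_Y)$. Then $\Delta_{X,Y}\circ\nabla_{X,Y}=\mathrm{id}_{PX\otimes PY}$. Consequently the inclusion $\nabla_{X,Y}$ of product measures into joint measures is an isometric embedding for the Kantorovich metric, and its image is a retract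 of the space $P(X\otimes Y)$ of all joints in the category of metric spaces and short maps: the map $\Delta_{X,Y}$ is short, and $r\mapsto\nabla_{X,Y}(\Delta_{X,Y}(r))$ is a short map from $P(X\otimes Y)$ onto the image of $\nabla_{X,Y}$ which restricts to the identity on that image. -/

import Mathlib

open MeasureTheory Set Filter Topology
open scoped ENNReal NNReal

namespace Kantorovich

universe u v

/-! ### The tensor product of metric spaces -/

/-- The underlying set of `X ⊗ Y` is the set of pairs `(x, y)`. It is a separate type because its
metric (below) is the sum metric, not Mathlib's maximum metric on `X × Y`. -/
@[ext]
structure Tensor (X : Type u) (Y : Type v) : Type (max u v) where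
  fst : X
  snd : Y

namespace Tensor

variable {X : Type u} {Y : Type v}

/-- The metric `d((x, y), (x', y')) = d(x, x') + d(y, y')`. -/
instance [MetricSpace X] [MetricSpace Y] : MetricSpace (Tensor X Y) where
  dist z w := dist z.fst w.fst + dist z.snd w.snd
  dist_self z := by simp
  dist_comm z w := by simp only [dist_comm]
  dist_triangle z w t := by
    have h₁ := dist_triangle z.fst w.fst t.fst
    have h₂ := dist_triangle z.snd w.snd t.snd
    linarith
  eq_of_dist_eq_zero := by
    intro z w h
    have h₁ := dist_nonneg (x := z.fst) (y := w.fst)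
    have h₂ := dist_nonneg (x := z.snd) (y := w.snd)
    exact Tensor.ext (dist_eq_zero.1 (by linarith)) (dist_eq_zero.1 (by linarith))

theorem dist_def [MetricSpace X] [MetricSpace Y] (z w : Tensor X Y) :
    dist z w = dist z.fst w.fst + dist z.snd w.snd := rfl

/-- `X ⊗ Y` carries the Borel sigma-algebra of its metric. (For non-separable `X` and `Y` it may
be strictly larger than the product sigma-algebra.) -/
instance [MetricSpace X] [MetricSpace Y] : MeasurableSpace (Tensor X Y) := borel _

instance [MetricSpace X] [MetricSpace Y] : BorelSpace (Tensor X Y) := ⟨rfl⟩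

theorem lipschitz_fst [MetricSpace X] [MetricSpace Y] :
    LipschitzWith 1 (Tensor.fst : Tensor X Y → X) :=
  LipschitzWith.of_dist_le_mul fun z w => by
    have := dist_nonneg (x := z.snd) (y := w.snd)
    simp only [dist_def, NNReal.coe_one, one_mul]
    linarith

theorem lipschitz_snd [MetricSpace X] [MetricSpace Y] :
    LipschitzWith 1 (Tensor.snd : Tensor X Y → Y) :=
  LipschitzWith.of_dist_le_mul fun z w => by
    have := dist_nonneg (x := z.fst) (y := w.fst)
    simp only [dist_def, NNReal.coe_one, one_mul]
    linarith

theorem lipschitz_mk_left [MetricSpace X] [MetricSpace Y] (x : X) :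
    LipschitzWith 1 (Tensor.mk x : Y → Tensor X Y) :=
  LipschitzWith.of_dist_le_mul fun z w => by simp [dist_def]

theorem lipschitz_mk_right [MetricSpace X] [MetricSpace Y] (y : Y) :
    LipschitzWith 1 (fun x : X => (Tensor.mk x y : Tensor X Y)) :=
  LipschitzWith.of_dist_le_mul fun z w => by simp [dist_def]

theorem continuous_mk [MetricSpace X] [MetricSpace Y] :
    Continuous (fun z : X × Y => (Tensor.mk z.1 z.2 : Tensor X Y)) := by
  refine (LipschitzWith.of_dist_le_mul (K := 2) fun z w => ?_).continuous
  have h₁ : dist z.1 w.1 ≤ dist z w := le_max_left _ _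
  have h₂ : dist z.2 w.2 ≤ dist z w := le_max_right _ _
  simp only [dist_def, NNReal.coe_ofNat]
  linarith

end Tensor

/-! ### The Kantorovich space -/

/-- The set `PX` of Radon probability measures on `X` with finite first moment. A Borel probability
measure is Radon when the measure of every Borel set is the supremum of the measures of its compact
subsets; the first moment is finite when every short (that is, `1`-Lipschitz) real function is
integrable. -/
structure PSpace (X : Type u) [MetricSpace X] [MeasurableSpace X] [BorelSpace X] : Type u where
  toMeasure : Measure X
  isProbabilityMeasure : IsProbabilityMeasure toMeasure
  innerRegular : toMeasure.InnerRegular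
  integrable_of_short : ∀ f : X → ℝ, LipschitzWith 1 f → Integrable f toMeasure

attribute [instance] PSpace.isProbabilityMeasure PSpace.innerRegular

namespace PSpace

section Metric

variable {X : Type u} [MetricSpace X] [MeasurableSpace X] [BorelSpace X]

theorem nonempty (p : PSpace X) : Nonempty X := nonempty_of_isProbabilityMeasure p.toMeasure

/-- `d(p, q) = sup |∫ f dp - ∫ f dq|`, the supremum being over all short `f : X → ℝ`. -/
noncomputable instance : Dist (PSpace X) where
  dist p q := ⨆ f : {f : X → ℝ // LipschitzWith 1 f},
    |∫ x, f.1 x ∂p.toMeasure - ∫ x, f.1 x ∂q.toMeasure|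

theorem dist_def (p q : PSpace X) :
    dist p q = ⨆ f : {f : X → ℝ // LipschitzWith 1 f},
      |∫ x, f.1 x ∂p.toMeasure - ∫ x, f.1 x ∂q.toMeasure| := rfl

instance : Nonempty {f : X → ℝ // LipschitzWith 1 f} :=
  ⟨⟨fun _ => 0, LipschitzWith.const' 0⟩⟩

theorem integrable_dist (p : PSpace X) (x₀ : X) :
    Integrable (fun x => dist x x₀) p.toMeasure :=
  p.integrable_of_short _ (LipschitzWith.dist_left x₀)

/-- The supremum defining the Kantorovich distance is finite. -/
theorem bddAbove_dist (p q : PSpace X) :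
    BddAbove (range fun f : {f : X → ℝ // LipschitzWith 1 f} =>
      |∫ x, f.1 x ∂p.toMeasure - ∫ x, f.1 x ∂q.toMeasure|) := by
  obtain ⟨x₀⟩ := p.nonempty
  have key : ∀ (r : PSpace X) (f : X → ℝ), LipschitzWith 1 f →
      |∫ x, f x ∂r.toMeasure - f x₀| ≤ ∫ x, dist x x₀ ∂r.toMeasure := by
    intro r f hf
    have h : ∫ x, f x ∂r.toMeasure - f x₀ = ∫ x, (f x - f x₀) ∂r.toMeasure := by
      rw [integral_sub (r.integrable_of_short f hf) (integrable_const _)]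
      simp
    rw [h]
    refine (abs_integral_le_integral_abs).trans ?_
    refine integral_mono ((r.integrable_of_short f hf).sub (integrable_const _)).abs
      (r.integrable_dist x₀) fun x => ?_
    simpa [Real.dist_eq] using hf.dist_le_mul x x₀
  refine ⟨∫ x, dist x x₀ ∂p.toMeasure + ∫ x, dist x x₀ ∂q.toMeasure, ?_⟩
  rintro _ ⟨f, rfl⟩
  have h₁ := key p f.1 f.2
  have h₂ := key q f.1 f.2
  rw [abs_le] at h₁ h₂
  simp only [abs_le]
  constructor <;> linarith [h₁.1, h₁.2, h₂.1, h₂.2]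

theorem le_dist (p q : PSpace X) {f : X → ℝ} (hf : LipschitzWith 1 f) :
    |∫ x, f x ∂p.toMeasure - ∫ x, f x ∂q.toMeasure| ≤ dist p q :=
  le_ciSup (bddAbove_dist p q) ⟨f, hf⟩

theorem eq_of_toMeasure_eq {p q : PSpace X} (h : p.toMeasure = q.toMeasure) : p = q := by
  cases p; cases q; cases h; rfl

/-- A measure in `PX` is determined by its integrals of short functions. -/
theorem eq_of_forall_integral_eq {p q : PSpace X}
    (h : ∀ f : X → ℝ, LipschitzWith 1 f → ∫ x, f x ∂p.toMeasure = ∫ x, f x ∂q.toMeasure) :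
    p = q := by
  refine eq_of_toMeasure_eq ?_
  refine ext_of_generate_finite (m0 := inferInstance) {F : Set X | IsClosed F} ?_
    isPiSystem_isClosed (fun F hF => ?_) (by simp)
  · rw [BorelSpace.measurable_eq (α := X), borel_eq_generateFrom_isClosed]
  have hδ : ∀ n : ℕ, (0 : ℝ) < 1 / ((n : ℝ) + 1) := fun n => by positivity
  have hp := tendsto_integral_thickenedIndicator_of_isClosed p.toMeasure hF hδ
    tendsto_one_div_add_atTop_nhds_zero_nat
  have hq := tendsto_integral_thickenedIndicator_of_isClosed q.toMeasure hF hδ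
    tendsto_one_div_add_atTop_nhds_zero_nat
  have heq : ∀ n : ℕ, ∫ x, (thickenedIndicator (hδ n) F x : ℝ) ∂p.toMeasure
      = ∫ x, (thickenedIndicator (hδ n) F x : ℝ) ∂q.toMeasure := by
    intro n
    have hlip : LipschitzWith 1
        (fun x => 1 / ((n : ℝ) + 1) * (thickenedIndicator (hδ n) F x : ℝ)) := by
      refine LipschitzWith.of_dist_le_mul fun x y => ?_
      have h₁ := (lipschitzWith_thickenedIndicator (hδ n) F).dist_le_mul x y
      rw [NNReal.dist_eq, NNReal.coe_inv, Real.coe_toNNReal _ (hδ n).le] at h₁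
      rw [Real.dist_eq, ← mul_sub, abs_mul, abs_of_pos (hδ n), NNReal.coe_one, one_mul]
      calc _ ≤ 1 / ((n : ℝ) + 1) * ((1 / ((n : ℝ) + 1))⁻¹ * dist x y) := by
            gcongr
        _ = dist x y := by
            rw [← mul_assoc, mul_inv_cancel₀ (hδ n).ne', one_mul]
    have h₂ := h _ hlip
    rw [integral_const_mul, integral_const_mul] at h₂
    exact mul_left_cancel₀ (hδ n).ne' h₂
  simp only [heq] at hp
  have := tendsto_nhds_unique hp hq
  rwa [measureReal_def, measureReal_def,
    ENNReal.toReal_eq_toReal_iff' (measure_ne_top _ _) (measure_ne_top _ _)] at this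

/-- The Kantorovich-Wasserstein metric on `PX`. -/
noncomputable instance : MetricSpace (PSpace X) where
  dist_self p := by simp [dist_def]
  dist_comm p q := by simp only [dist_def, abs_sub_comm]
  dist_triangle p q r := by
    rw [dist_def p r]
    refine ciSup_le fun f => ?_
    exact (abs_sub_le _ (∫ x, f.1 x ∂q.toMeasure) _).trans
      (add_le_add (le_dist p q f.2) (le_dist q r f.2))
  eq_of_dist_eq_zero := by
    intro p q h
    refine eq_of_forall_integral_eq fun f hf => ?_
    have h₁ := le_dist p q hf
    rw [h] at h₁
    exact sub_eq_zero.1 (abs_nonpos_iff.1 h₁)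

end Metric

section Map

variable {X : Type u} {Y : Type v} [MetricSpace X] [MeasurableSpace X] [BorelSpace X]
  [MetricSpace Y] [MeasurableSpace Y] [BorelSpace Y]

/-- The push-forward `f_* p` along a short map `f`. -/
noncomputable def map (f : X → Y) (hf : LipschitzWith 1 f) (p : PSpace X) : PSpace Y where
  toMeasure := p.toMeasure.map f
  isProbabilityMeasure := Measure.isProbabilityMeasure_map hf.continuous.aemeasurable
  innerRegular := Measure.InnerRegular.map_of_continuous hf.continuous
  integrable_of_short g hg := by
    rw [integrable_map_measure hg.continuous.aestronglyMeasurable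
      hf.continuous.aemeasurable]
    exact p.integrable_of_short _ (by simpa using hg.comp hf)

/-- The map `Δ : P(X ⊗ Y) → PX ⊗ PY` sending a joint measure `r` to its pair of marginals. -/
noncomputable def marginals (r : PSpace (Tensor X Y)) : Tensor (PSpace X) (PSpace Y) :=
  ⟨r.map Tensor.fst Tensor.lipschitz_fst, r.map Tensor.snd Tensor.lipschitz_snd⟩

end Map

section ProductJoint

variable {X : Type u} {Y : Type v} [MetricSpace X] [MeasurableSpace X] [BorelSpace X]
  [MetricSpace Y] [MeasurableSpace Y] [BorelSpace Y]

/-- Radon probability measures are tight. -/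
theorem exists_isCompact_compl_le (p : PSpace X) {ε : ℝ≥0∞} (hε : 0 < ε) :
    ∃ K : Set X, IsCompact K ∧ p.toMeasure Kᶜ ≤ ε := by
  obtain ⟨K, hK, h⟩ := isTightMeasureSet_iff_exists_isCompact_measure_compl_le.1
    (isTightMeasureSet_singleton_of_innerRegular (μ := p.toMeasure)) ε hε
  exact ⟨K, hK, h _ rfl⟩

/-- A Radon probability measure is concentrated on a separable Borel set. -/
theorem exists_isSeparable (p : PSpace X) :
    ∃ B : Set X, MeasurableSet B ∧ TopologicalSpace.IsSeparable B ∧ p.toMeasure Bᶜ = 0 := by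
  have h : ∀ n : ℕ, ∃ K : Set X, IsCompact K ∧ p.toMeasure Kᶜ ≤ ((n : ℝ≥0∞) + 1)⁻¹ :=
    fun n => p.exists_isCompact_compl_le (by simp)
  choose K hK hKn using h
  refine ⟨⋃ n, K n, MeasurableSet.iUnion fun n => (hK n).measurableSet,
    TopologicalSpace.IsSeparable.iUnion fun n => (hK n).isSeparable, ?_⟩
  refine le_antisymm (ge_of_tendsto' (ENNReal.tendsto_inv_nat_nhds_zero.comp
    (tendsto_add_atTop_nat 1)) fun n => ?_) zero_le
  refine (measure_mono (compl_subset_compl.2 (subset_iUnion K n))).trans ?_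
  simpa using hKn n

/-- The family of measures `δ_x ⊗ q` on `X ⊗ Y` depends measurably on `x`. -/
theorem measurable_map_mk (q : PSpace Y) :
    Measurable fun x : X => q.toMeasure.map (Tensor.mk x : Y → Tensor X Y) := by
  obtain ⟨B, hB, hBs, hB0⟩ := q.exists_isSeparable
  have : SecondCountableTopology B := hBs.secondCountableTopology
  refine Measure.measurable_of_measurable_coe _ fun S hS => ?_
  have hcont : Continuous fun z : X × B => (Tensor.mk z.1 (z.2 : Y) : Tensor X Y) :=
    Tensor.continuous_mk.comp (continuous_fst.prodMk (continuous_subtype_val.comp continuous_snd))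
  have hT : MeasurableSet ((fun z : X × B => (Tensor.mk z.1 (z.2 : Y) : Tensor X Y)) ⁻¹' S) :=
    hcont.measurable hS
  have : IsFiniteMeasure (q.toMeasure.comap (Subtype.val : B → Y)) := inferInstance
  convert! (measurable_measure_prodMk_left (ν := q.toMeasure.comap (Subtype.val : B → Y))
    hT) using 1
  funext x
  have hS' : MeasurableSet ((Tensor.mk x : Y → Tensor X Y) ⁻¹' S) :=
    (Tensor.lipschitz_mk_left x).continuous.measurable hS
  rw [Measure.map_apply (Tensor.lipschitz_mk_left x).continuous.measurable hS,
    comap_subtype_coe_apply hB]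
  have himg : (Subtype.val '' (Prod.mk x ⁻¹'
      ((fun z : X × B => (Tensor.mk z.1 (z.2 : Y) : Tensor X Y)) ⁻¹' S)) : Set Y)
      = (Tensor.mk x : Y → Tensor X Y) ⁻¹' S ∩ B := by
    ext y
    constructor
    · rintro ⟨⟨b, hb⟩, hbS, rfl⟩
      exact ⟨hbS, hb⟩
    · rintro ⟨hy, hyB⟩
      exact ⟨⟨y, hyB⟩, hy, rfl⟩
  rw [himg]
  refine le_antisymm ?_ (measure_mono inter_subset_left)
  calc _ ≤ q.toMeasure ((Tensor.mk x : Y → Tensor X Y) ⁻¹' S ∩ B ∪ Bᶜ) := by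
        refine measure_mono fun y hy => ?_
        by_cases hyB : y ∈ B
        · exact Or.inl ⟨hy, hyB⟩
        · exact Or.inr hyB
    _ ≤ _ := (measure_union_le _ _).trans (by rw [hB0, add_zero])

/-- The product measure of `p` and `q` on the Borel sets of `X ⊗ Y`, that is
`S ↦ ∫ q {y | (x, y) ∈ S} dp(x)`. -/
noncomputable def prodMeasure (p : PSpace X) (q : PSpace Y) : Measure (Tensor X Y) :=
  p.toMeasure.bind fun x => q.toMeasure.map (Tensor.mk x)

theorem prodMeasure_apply (p : PSpace X) (q : PSpace Y) {S : Set (Tensor X Y)}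
    (hS : MeasurableSet S) :
    prodMeasure p q S = ∫⁻ x, q.toMeasure {y | Tensor.mk x y ∈ S} ∂p.toMeasure := by
  rw [prodMeasure, Measure.bind_apply hS (measurable_map_mk q).aemeasurable]
  refine lintegral_congr fun x => ?_
  rw [Measure.map_apply (Tensor.lipschitz_mk_left x).continuous.measurable hS]
  rfl

theorem isProbabilityMeasure_prodMeasure (p : PSpace X) (q : PSpace Y) :
    IsProbabilityMeasure (prodMeasure p q) :=
  ⟨by simp [prodMeasure_apply p q MeasurableSet.univ]⟩

theorem map_fst_prodMeasure (p : PSpace X) (q : PSpace Y) :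
    (prodMeasure p q).map Tensor.fst = p.toMeasure := by
  ext A hA
  have hm : Measurable (Tensor.fst : Tensor X Y → X) :=
    Tensor.lipschitz_fst.continuous.measurable
  rw [Measure.map_apply hm hA, prodMeasure_apply p q (hm hA), ← lintegral_indicator_one hA]
  refine lintegral_congr fun x => ?_
  by_cases hx : x ∈ A <;> simp [hx]

theorem map_snd_prodMeasure (p : PSpace X) (q : PSpace Y) :
    (prodMeasure p q).map Tensor.snd = q.toMeasure := by
  ext A hA
  have hm : Measurable (Tensor.snd : Tensor X Y → Y) :=
    Tensor.lipschitz_snd.continuous.measurable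
  rw [Measure.map_apply hm hA, prodMeasure_apply p q (hm hA)]
  simp

theorem innerRegular_prodMeasure (p : PSpace X) (q : PSpace Y) :
    (prodMeasure p q).InnerRegular := by
  have := isProbabilityMeasure_prodMeasure p q
  have hcl : (prodMeasure p q).InnerRegularWRT IsCompact IsClosed := by
    refine innerRegularWRT_of_exists_compl_lt (fun A B hA hB => hA.inter_right hB) fun ε hε => ?_
    obtain ⟨δ, hδ, hδε⟩ := exists_between hε
    obtain ⟨K, hK, hKδ⟩ := p.exists_isCompact_compl_le (ENNReal.half_pos hδ.ne')
    obtain ⟨L, hL, hLδ⟩ := q.exists_isCompact_compl_le (ENNReal.half_pos hδ.ne')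
    refine ⟨(fun z : X × Y => (Tensor.mk z.1 z.2 : Tensor X Y)) '' (K ×ˢ L),
      (hK.prod hL).image Tensor.continuous_mk, lt_of_le_of_lt ?_ hδε⟩
    have hsub : ((fun z : X × Y => (Tensor.mk z.1 z.2 : Tensor X Y)) '' (K ×ˢ L))ᶜ
        ⊆ Tensor.fst ⁻¹' Kᶜ ∪ Tensor.snd ⁻¹' Lᶜ := by
      intro z hz
      by_contra hcon
      simp only [mem_union, mem_preimage, mem_compl_iff, not_or, not_not] at hcon
      exact hz ⟨(z.fst, z.snd), hcon, rfl⟩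
    have h₁ := Measure.map_apply (μ := prodMeasure p q)
      (Tensor.lipschitz_fst (X := X) (Y := Y)).continuous.measurable hK.measurableSet.compl
    have h₂ := Measure.map_apply (μ := prodMeasure p q)
      (Tensor.lipschitz_snd (X := X) (Y := Y)).continuous.measurable hL.measurableSet.compl
    rw [map_fst_prodMeasure] at h₁
    rw [map_snd_prodMeasure] at h₂
    calc _ ≤ _ := measure_mono hsub
      _ ≤ _ := measure_union_le _ _
      _ ≤ δ / 2 + δ / 2 := add_le_add (h₁ ▸ hKδ) (h₂ ▸ hLδ)
      _ = δ := ENNReal.add_halves δ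
  refine ⟨fun S hS r hr => ?_⟩
  obtain ⟨F, hFS, hF, hrF⟩ := hS.exists_lt_isClosed_of_ne_top (measure_ne_top _ _) hr
  obtain ⟨K, hKF, hK, hrK⟩ := hcl hF r hrF
  exact ⟨K, hKF.trans hFS, hK, hrK⟩

theorem integrable_prodMeasure (p : PSpace X) (q : PSpace Y) (f : Tensor X Y → ℝ)
    (hf : LipschitzWith 1 f) : Integrable f (prodMeasure p q) := by
  have := isProbabilityMeasure_prodMeasure p q
  obtain ⟨x₀⟩ := p.nonempty
  obtain ⟨y₀⟩ := q.nonempty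
  have h₁ : Integrable (fun z : Tensor X Y => dist z.fst x₀) (prodMeasure p q) := by
    have h := p.integrable_dist x₀
    rw [← map_fst_prodMeasure p q] at h
    exact h.comp_measurable Tensor.lipschitz_fst.continuous.measurable
  have h₂ : Integrable (fun z : Tensor X Y => dist z.snd y₀) (prodMeasure p q) := by
    have h := q.integrable_dist y₀
    rw [← map_snd_prodMeasure p q] at h
    exact h.comp_measurable Tensor.lipschitz_snd.continuous.measurable
  refine ((integrable_const |f ⟨x₀, y₀⟩|).add (h₁.add h₂)).mono'
    hf.continuous.aestronglyMeasurable (Eventually.of_forall fun z => ?_)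
  have h := hf.dist_le_mul z ⟨x₀, y₀⟩
  rw [Real.dist_eq, Tensor.dist_def, NNReal.coe_one, one_mul] at h
  have h' := abs_sub_abs_le_abs_sub (f z) (f ⟨x₀, y₀⟩)
  simp only [Real.norm_eq_abs, Pi.add_apply]
  linarith

/-- The map `∇ : PX ⊗ PY → P(X ⊗ Y)` sending `(p, q)` to the product joint `p ⊗ q`. -/
noncomputable def productJoint (z : Tensor (PSpace X) (PSpace Y)) : PSpace (Tensor X Y) where
  toMeasure := prodMeasure z.fst z.snd
  isProbabilityMeasure := isProbabilityMeasure_prodMeasure z.fst z.snd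
  innerRegular := innerRegular_prodMeasure z.fst z.snd
  integrable_of_short := integrable_prodMeasure z.fst z.snd

/-- The product joint is the measure with `∫ f d(p ⊗ q) = ∫∫ f(x, y) dq(y) dp(x)` for short `f`;
by `eq_of_forall_integral_eq` this determines it. -/
theorem integral_productJoint (p : PSpace X) (q : PSpace Y) (f : Tensor X Y → ℝ)
    (hf : LipschitzWith 1 f) :
    ∫ z, f z ∂(productJoint ⟨p, q⟩).toMeasure
      = ∫ x, ∫ y, f ⟨x, y⟩ ∂q.toMeasure ∂p.toMeasure := by
  have h := (integrable_prodMeasure p q f hf)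
  let κ : ProbabilityTheory.Kernel X (Tensor X Y) :=
    ⟨fun x => q.toMeasure.map (Tensor.mk x), measurable_map_mk q⟩
  have key : ∫ z, f z ∂(p.toMeasure.bind κ) = ∫ x, ∫ z, f z ∂(κ x) ∂p.toMeasure :=
    ProbabilityTheory.Kernel.integral_comp (η := κ)
      (κ := ProbabilityTheory.Kernel.const Unit p.toMeasure) (a := ()) h
  refine key.trans (integral_congr_ae (Eventually.of_forall fun x => ?_))
  exact integral_map (Tensor.lipschitz_mk_left x).continuous.aemeasurable
    hf.continuous.aestronglyMeasurable

end ProductJoint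

end PSpace
end Kantorovich

open Kantorovich

/-!
The map `Δ` (`PSpace.marginals`) and the map `∇` (`PSpace.productJoint`) are both short, and
`Δ ∘ ∇ = id` because the marginals of a product measure are its factors. A short map with a short
left inverse is an isometry, and `∇ ∘ Δ` is then a short retraction onto the image of `∇`.

* `Δ` is short (`PSpace.lipschitzWith_marginals`): if `f` on `X` and `g` on `Y` are short, then
  `(x, y) ↦ f x + g y` is short for the sum metric on `X ⊗ Y`, and its integral against a joint
  measure is the sum of the integrals of `f` and `g` against the marginals. Since short
  functions are closed under negation, the distance is a supremum of differences without absolute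
  value (`PSpace.dist_le_of_forall`), so taking suprema over `f` and `g` separately bounds the sum
  of the distances of the marginals by the distance of the joints.
* `∇` is short (`PSpace.lipschitzWith_productJoint`): integrate by Fubini and change one factor at a
  time. Changing `p` costs at most `d(p, p')`, because `x ↦ ∫ f(x, y) dq(y)` is again short; changing
  `q` costs at most `d(q, q')` for each `x`, because `f(x, ·)` is short.
-/

namespace Kantorovich

namespace Tensor

variable {X : Type*} {Y : Type*} [MetricSpace X] [MetricSpace Y]

theorem lipschitzWith_add {f : X → ℝ} {g : Y → ℝ} (hf : LipschitzWith 1 f)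
    (hg : LipschitzWith 1 g) : LipschitzWith 1 fun z : Tensor X Y => f z.fst + g z.snd :=
  LipschitzWith.of_dist_le_mul fun z w => by
    have hfzw := hf.dist_le_mul z.fst w.fst
    have hgzw := hg.dist_le_mul z.snd w.snd
    simp only [NNReal.coe_one, one_mul] at hfzw hgzw ⊢
    exact (dist_add_add_le _ _ _ _).trans (add_le_add hfzw hgzw)

end Tensor

namespace PSpace

variable {X : Type*} {Y : Type*} [MetricSpace X] [MetricSpace Y] [MeasurableSpace Y] [BorelSpace Y]

theorem lipschitzWith_integral_mk (q : PSpace Y) {f : Tensor X Y → ℝ} (hf : LipschitzWith 1 f) :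
    LipschitzWith 1 fun x => ∫ y, f ⟨x, y⟩ ∂q.toMeasure := by
  have hint : ∀ x, Integrable (fun y => f ⟨x, y⟩) q.toMeasure := fun x =>
    q.integrable_of_short _ (by
      simpa [Function.comp_def] using hf.comp (Tensor.lipschitz_mk_left x))
  refine LipschitzWith.of_le_add fun x x' => ?_
  calc ∫ y, f ⟨x, y⟩ ∂q.toMeasure ≤ ∫ y, (f ⟨x', y⟩ + dist x x') ∂q.toMeasure := by
        refine integral_mono (hint x) ((hint x').add (integrable_const _)) fun y => ?_
        have h := hf.dist_le_mul ⟨x, y⟩ ⟨x', y⟩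
        rw [Real.dist_eq, Tensor.dist_def, dist_self, add_zero, NNReal.coe_one, one_mul] at h
        linarith [le_abs_self (f ⟨x, y⟩ - f ⟨x', y⟩)]
    _ = ∫ y, f ⟨x', y⟩ ∂q.toMeasure + dist x x' := by
        rw [integral_add (hint x') (integrable_const _)]
        simp

variable [MeasurableSpace X] [BorelSpace X]

/-- No absolute value is needed in an upper bound for the Kantorovich distance, because the short
functions are closed under negation. -/
theorem dist_le_of_forall {p q : PSpace X} {c : ℝ}
    (h : ∀ f : X → ℝ, LipschitzWith 1 f →
      ∫ x, f x ∂p.toMeasure - ∫ x, f x ∂q.toMeasure ≤ c) :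
    dist p q ≤ c := by
  refine ciSup_le fun f => abs_le'.2 ⟨h f.1 f.2, ?_⟩
  simpa [integral_neg, sub_eq_add_neg, add_comm] using h (fun x => -f.1 x) f.2.neg

theorem integral_sub_le_dist (p q : PSpace X) {f : X → ℝ} (hf : LipschitzWith 1 f) :
    ∫ x, f x ∂p.toMeasure - ∫ x, f x ∂q.toMeasure ≤ dist p q :=
  (le_abs_self _).trans (le_dist p q hf)

theorem integral_map {f : X → Y} (hf : LipschitzWith 1 f) (p : PSpace X) {g : Y → ℝ}
    (hg : LipschitzWith 1 g) :
    ∫ y, g y ∂(p.map f hf).toMeasure = ∫ x, g (f x) ∂p.toMeasure :=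
  MeasureTheory.integral_map hf.continuous.aemeasurable hg.continuous.aestronglyMeasurable

theorem marginals_productJoint (z : Tensor (PSpace X) (PSpace Y)) :
    marginals (productJoint z) = z :=
  Tensor.ext (eq_of_toMeasure_eq (map_fst_prodMeasure z.fst z.snd))
    (eq_of_toMeasure_eq (map_snd_prodMeasure z.fst z.snd))

theorem integral_add_eq_marginals (r : PSpace (Tensor X Y)) {f : X → ℝ} {g : Y → ℝ}
    (hf : LipschitzWith 1 f) (hg : LipschitzWith 1 g) :
    ∫ z, (f z.fst + g z.snd) ∂r.toMeasure
      = ∫ x, f x ∂(marginals r).fst.toMeasure + ∫ y, g y ∂(marginals r).snd.toMeasure := by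
  rw [integral_add
    (r.integrable_of_short _ (by simpa [Function.comp_def] using hf.comp Tensor.lipschitz_fst))
    (r.integrable_of_short _ (by simpa [Function.comp_def] using hg.comp Tensor.lipschitz_snd))]
  exact congrArg₂ (· + ·) (integral_map Tensor.lipschitz_fst r hf).symm
    (integral_map Tensor.lipschitz_snd r hg).symm

theorem lipschitzWith_marginals :
    LipschitzWith 1 (marginals : PSpace (Tensor X Y) → Tensor (PSpace X) (PSpace Y)) := by
  refine LipschitzWith.of_dist_le_mul fun r s => ?_
  rw [NNReal.coe_one, one_mul, Tensor.dist_def, ← le_sub_iff_add_le]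
  refine dist_le_of_forall fun f hf => ?_
  rw [le_sub_comm]
  refine dist_le_of_forall fun g hg => ?_
  have h := integral_sub_le_dist r s (Tensor.lipschitzWith_add hf hg)
  rw [integral_add_eq_marginals r hf hg, integral_add_eq_marginals s hf hg] at h
  linarith

theorem lipschitzWith_productJoint :
    LipschitzWith 1 (productJoint : Tensor (PSpace X) (PSpace Y) → PSpace (Tensor X Y)) := by
  refine LipschitzWith.of_dist_le_mul ?_
  rintro ⟨p, q⟩ ⟨p', q'⟩
  rw [NNReal.coe_one, one_mul, Tensor.dist_def]
  refine dist_le_of_forall fun f hf => ?_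
  rw [integral_productJoint p q f hf, integral_productJoint p' q' f hf]
  have hfst := integral_sub_le_dist p p' (lipschitzWith_integral_mk q hf)
  have hsnd : ∫ x, ∫ y, f ⟨x, y⟩ ∂q.toMeasure ∂p'.toMeasure
      ≤ ∫ x, (∫ y, f ⟨x, y⟩ ∂q'.toMeasure + dist q q') ∂p'.toMeasure := by
    refine integral_mono (p'.integrable_of_short _ (lipschitzWith_integral_mk q hf))
      ((p'.integrable_of_short _ (lipschitzWith_integral_mk q' hf)).add (integrable_const _))
      fun x => ?_
    have hfx : LipschitzWith 1 fun y => f ⟨x, y⟩ := by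
      simpa [Function.comp_def] using hf.comp (Tensor.lipschitz_mk_left x)
    exact sub_le_iff_le_add'.1 (integral_sub_le_dist q q' hfx)
  rw [integral_add (p'.integrable_of_short _ (lipschitzWith_integral_mk q' hf))
    (integrable_const _)] at hsnd
  simp only [integral_const, probReal_univ, smul_eq_mul, one_mul] at hsnd
  linarith

theorem isometry_productJoint :
    Isometry (productJoint : Tensor (PSpace X) (PSpace Y) → PSpace (Tensor X Y)) := by
  refine Isometry.of_dist_eq fun z w => le_antisymm ?_ ?_
  · simpa using lipschitzWith_productJoint.dist_le_mul z w
  · simpa [marginals_productJoint] using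
      lipschitzWith_marginals.dist_le_mul (productJoint z) (productJoint w)

end PSpace
end Kantorovich

theorem mainTheorem6
    {X : Type*} [MetricSpace X] [CompleteSpace X] [MeasurableSpace X] [BorelSpace X]
    {Y : Type*} [MetricSpace Y] [CompleteSpace Y] [MeasurableSpace Y] [BorelSpace Y] :
    (PSpace.marginals ∘ PSpace.productJoint :
        Tensor (PSpace X) (PSpace Y) → Tensor (PSpace X) (PSpace Y)) = id ∧
    Isometry (PSpace.productJoint : Tensor (PSpace X) (PSpace Y) → PSpace (Tensor X Y)) ∧
    LipschitzWith 1 (PSpace.marginals : PSpace (Tensor X Y) → Tensor (PSpace X) (PSpace Y)) ∧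
    ∃ ρ : PSpace (Tensor X Y) →
        Set.range (PSpace.productJoint : Tensor (PSpace X) (PSpace Y) → PSpace (Tensor X Y)),
      LipschitzWith 1 ρ ∧
      (∀ r, (ρ r : PSpace (Tensor X Y)) = PSpace.productJoint (PSpace.marginals r)) ∧
      ∀ r ∈ Set.range (PSpace.productJoint : Tensor (PSpace X) (PSpace Y) → PSpace (Tensor X Y)),
        (ρ r : PSpace (Tensor X Y)) = r := by
  refine ⟨funext PSpace.marginals_productJoint, PSpace.isometry_productJoint,
    PSpace.lipschitzWith_marginals,
    fun r => ⟨PSpace.productJoint (PSpace.marginals r), mem_range_self _⟩, ?_, fun r => rfl, ?_⟩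
  · have h := (PSpace.lipschitzWith_productJoint (X := X) (Y := Y)).comp
      PSpace.lipschitzWith_marginals
    rw [one_mul] at h
    exact h.subtype_mk _
  · rintro _ ⟨z, rfl⟩
    exact congrArg PSpace.productJoint (PSpace.marginals_productJoint z)
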